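/- Let $\mathcal X,\mathcal Y$ be finite sets, let $\{M(y)\}_{y\in\mathcal Y}$ be a family of entrywise nonnegative $\mathcal X\times\mathcal X$ matrices ("stepping matrices") whose sum $M=\sum_{y}M(y)$ is a Markov transition (row-stochastic) matrix, and let $\mathcal M=\{M(y):y\in\mathcal Y\}$. Let $\Delta\subset\mathbb R^{\mathcal X}$ be the simplex of probability vectors on $\mathcal X$, with elements written as row vectors, let $e$ be the column vector of all ones, and let $\mathcal P(\Delta)$ be the set of Borel probability measures on $\Delta$ with the weak topology. Let $\mathcal M^*$ be the set of all finite products of stepping matrices, $\mathcal C=\{cW: c>0,\ W\in\mathcal M^*\}$, and $\overline{\mathcal C}$ its closure in the space of real $\mathcal X\times\mathcal X$ matrices. The $\alpha$-chain is the Markov chain on $\Delta$ that moves from $\alpha$ to $\alpha M(y)/(\alpha M(y)e)$ with probability $\alpha M(y)e$, for $y\in\mathcal Y$; its Markov operator on $C(\Delta)$ is $$(T_{\mathcal M}f)(\alpha)=\sum_{y}(\alpha M(y)e)\,f\!\left(\frac{\alpha M(y)}{\alpha M(y)e}\right),$$ where terms with $\alpha M(y)e=0$ are set equal to $0$, and $T_{\mathcal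 M}^*:\mathcal P(\Delta)\to\mathcal P(\Delta)$ is its adjoint, $\int f\,d(T^*_{\mathcal M}\mu)=\int T_{\mathcal M}f\,d\mu$. A stationary distribution is a $\lambda\in\mathcal P(\Delta)$ with $T_{\mathcal M}^*\lambda=\lambda$. **Theorem 2.** Suppose that $M$ is irreducible (for all $i,j$ there is $k\ge 1$ with $(M^k)_{ij}>0$) and that $\overline{\mathcal C}$ contains a matrix of rank $1$. Then $T_{\mathcal M}$ has a unique stationary distribution $\lambda$, and for every $\mu\in\mathcal P(\Delta)$, $(T_{\mathcal M}^*)^n\mu\to\lambda$ weakly in Cesàro mean, that is, $\frac1n\sum_{k=0}^{n-1}(T_{\mathcal M}^*)^k\mu\to\lambda$ weakly as $n\to\infty$. If, in addition, $M$ is aperiodic (there is a single $k\ge1$ with $(M^k)_{ij}>0$ for all $i,j$), then $(T_{\mathcal M}^*)^n\mu\to\lambda$ weakly as $n\to\infty$ for every $\mu\in\mathcal P(\Delta)$. -/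

import Mathlib

open MeasureTheory ProbabilityTheory Filter Topology
open scoped Matrix ENNReal

noncomputable section

/-- A finite family of nonnegative square matrices `M y`, the stepping matrices, whose sum is a
Markov transition (row-stochastic) matrix. -/
structure SteppingFamily (X Y : Type*) [Fintype X] [DecidableEq X] [Fintype Y] where
  /-- The stepping matrix attached to the output symbol `y`. -/
  mat : Y → Matrix X X ℝ
  mat_nonneg : ∀ y i j, 0 ≤ mat y i j
  sum_mem : ∑ y, mat y ∈ Matrix.rowStochastic ℝ X

namespace SteppingFamily

variable {X Y : Type*} [Fintype X] [DecidableEq X] [Fintype Y]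

/-- The transition matrix `M = ∑ y, M y` of the hidden chain. -/
def trans (D : SteppingFamily X Y) : Matrix X X ℝ := ∑ y, D.mat y

/-- The set of all finite products of stepping matrices. -/
def words (D : SteppingFamily X Y) : Set (Matrix X X ℝ) :=
  Set.range fun ys : List Y => (ys.map D.mat).prod

/-- The cone of all positive scalar multiples of finite products of stepping matrices. -/
def cone (D : SteppingFamily X Y) : Set (Matrix X X ℝ) :=
  {A | ∃ c : ℝ, 0 < c ∧ ∃ W ∈ D.words, A = c • W}

/-- The weight `α M(y) e`, the probability of the output `y` from the state `α`. -/
def weight (D : SteppingFamily X Y) (y : Y) (α : stdSimplex ℝ X) : ℝ :=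
  ∑ j, (α.1 ᵥ* D.mat y) j

theorem vecMul_nonneg (D : SteppingFamily X Y) (y : Y) (α : stdSimplex ℝ X) (j : X) :
    0 ≤ (α.1 ᵥ* D.mat y) j :=
  Finset.sum_nonneg fun i _ => mul_nonneg (α.2.1 i) (D.mat_nonneg y i j)

theorem weight_nonneg (D : SteppingFamily X Y) (y : Y) (α : stdSimplex ℝ X) :
    0 ≤ D.weight y α :=
  Finset.sum_nonneg fun j _ => D.vecMul_nonneg y α j

theorem sum_weight (D : SteppingFamily X Y) (α : stdSimplex ℝ X) :
    ∑ y, D.weight y α = 1 := by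
  have h : ∑ y, D.weight y α = ∑ j, (α.1 ᵥ* (∑ y, D.mat y)) j := by
    unfold weight
    rw [Finset.sum_comm]
    refine Finset.sum_congr rfl fun j _ => ?_
    simp only [Matrix.vecMul, dotProduct, Matrix.sum_apply, Finset.mul_sum]
    exact Finset.sum_comm
  rw [h]
  have hs := (Matrix.mem_rowStochastic_iff_sum.1 D.sum_mem).2
  simp only [Matrix.vecMul, dotProduct]
  rw [Finset.sum_comm]
  simp only [← Finset.mul_sum, hs, mul_one]
  exact α.2.2

/-- The updated state `α M(y) / (α M(y) e)`. When `α M(y) e = 0` it is given the irrelevant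
value `α`: such terms carry the weight `0` below. -/
def step (D : SteppingFamily X Y) (y : Y) (α : stdSimplex ℝ X) : stdSimplex ℝ X :=
  open Classical in
  if h : D.weight y α = 0 then α
  else ⟨(D.weight y α)⁻¹ • (α.1 ᵥ* D.mat y),
    fun j => mul_nonneg (inv_nonneg.2 (D.weight_nonneg y α)) (D.vecMul_nonneg y α j), by
      simp only [Pi.smul_apply, smul_eq_mul, ← Finset.mul_sum]
      exact inv_mul_cancel₀ h⟩

theorem continuous_vecMul (D : SteppingFamily X Y) (y : Y) :
    Continuous fun α : stdSimplex ℝ X => α.1 ᵥ* D.mat y :=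
  continuous_subtype_val.matrix_vecMul continuous_const

theorem continuous_weight (D : SteppingFamily X Y) (y : Y) : Continuous (D.weight y) :=
  continuous_finsetSum _ fun j _ => (continuous_apply j).comp (D.continuous_vecMul y)

theorem coe_step (D : SteppingFamily X Y) {y : Y} {α : stdSimplex ℝ X}
    (h : D.weight y α ≠ 0) :
    (D.step y α).1 = (D.weight y α)⁻¹ • (α.1 ᵥ* D.mat y) := by
  simp [step, h]

theorem measurable_step (D : SteppingFamily X Y) (y : Y) : Measurable (D.step y) := by
  classical
  refine Measurable.subtype_mk (f := fun α => (D.step y α).1) ?_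
    (h := fun α => (D.step y α).2)
  have : (fun α => (D.step y α).1) = fun α : stdSimplex ℝ X =>
      if D.weight y α = 0 then α.1
      else (D.weight y α)⁻¹ • (α.1 ᵥ* D.mat y) := by
    funext α
    by_cases h : D.weight y α = 0
    · simp [step, h]
    · simp [D.coe_step h, h]
  rw [this]
  exact Measurable.ite ((D.continuous_weight y).measurable (measurableSet_singleton 0))
    measurable_subtype_coe
    ((D.continuous_weight y).measurable.inv.smul (D.continuous_vecMul y).measurable)

theorem continuousAt_step (D : SteppingFamily X Y) {y : Y} {α : stdSimplex ℝ X}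
    (h : D.weight y α ≠ 0) : ContinuousAt (D.step y) α := by
  rw [Topology.IsInducing.subtypeVal.continuousAt_iff]
  have h1 : ContinuousAt (fun β : stdSimplex ℝ X =>
      (D.weight y β)⁻¹ • (β.1 ᵥ* D.mat y)) α :=
    ((D.continuous_weight y).continuousAt.inv₀ h).smul (D.continuous_vecMul y).continuousAt
  refine h1.congr ?_
  filter_upwards [(D.continuous_weight y).continuousAt.eventually_ne h] with β hβ
  exact (D.coe_step hβ).symm

/-- The Markov operator `T` of the `α`-chain on `C(Δ)`:
`(T f)(α) = ∑ y, (α M(y) e) f (α M(y) / (α M(y) e))`, terms with `α M(y) e = 0` being `0`. -/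
def markovOperator (D : SteppingFamily X Y) (f : C(stdSimplex ℝ X, ℝ)) :
    C(stdSimplex ℝ X, ℝ) where
  toFun α := ∑ y, D.weight y α * f (D.step y α)
  continuous_toFun := by
    refine continuous_finsetSum _ fun y _ => continuous_iff_continuousAt.2 fun α => ?_
    by_cases h : D.weight y α = 0
    · have hw : Tendsto (D.weight y) (𝓝 α) (𝓝 0) := by
        simpa [h] using (D.continuous_weight y).tendsto α
      have hb : ∀ β, ‖f (D.step y β)‖ ≤ ‖f‖ := fun β => f.norm_coe_le_norm _
      have : Tendsto (fun β => D.weight y β * f (D.step y β)) (𝓝 α) (𝓝 0) :=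
        hw.zero_mul_isBoundedUnder_le (isBoundedUnder_of ⟨‖f‖, hb⟩)
      simpa [ContinuousAt, h] using this
    · exact (D.continuous_weight y).continuousAt.mul
        (f.continuous.continuousAt.comp (D.continuousAt_step h))

/-- The transition kernel of the `α`-chain: from `α`, jump to `α M(y) / (α M(y) e)` with
probability `α M(y) e`. -/
def kernel (D : SteppingFamily X Y) : Kernel (stdSimplex ℝ X) (stdSimplex ℝ X) where
  toFun α := ∑ y, ENNReal.ofReal (D.weight y α) • Measure.dirac (D.step y α)
  measurable' := by
    refine Measure.measurable_of_measurable_coe _ fun s hs => ?_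
    simp only [Measure.coe_finsetSum, Finset.sum_apply, Measure.smul_apply, smul_eq_mul]
    refine Finset.measurable_sum _ fun y _ => ?_
    refine (D.continuous_weight y).measurable.ennreal_ofReal.mul ?_
    exact (Measure.measurable_coe hs).comp (Measure.measurable_dirac.comp (D.measurable_step y))

theorem kernel_apply (D : SteppingFamily X Y) (α : stdSimplex ℝ X) :
    D.kernel α = ∑ y, ENNReal.ofReal (D.weight y α) • Measure.dirac (D.step y α) := rfl

instance (D : SteppingFamily X Y) : IsMarkovKernel D.kernel where
  isProbabilityMeasure α := ⟨by
    simp only [kernel_apply, Measure.coe_finsetSum, Finset.sum_apply, Measure.smul_apply,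
      smul_eq_mul, measure_univ, mul_one]
    rw [← ENNReal.ofReal_sum_of_nonneg fun y _ => D.weight_nonneg y α, D.sum_weight,
      ENNReal.ofReal_one]⟩

/-- The adjoint `T*` of the Markov operator, acting on probability measures on the simplex:
`T* μ` is the law of the next state of the `α`-chain when the current state has law `μ`. -/
def dual (D : SteppingFamily X Y) (μ : ProbabilityMeasure (stdSimplex ℝ X)) :
    ProbabilityMeasure (stdSimplex ℝ X) :=
  ⟨(μ : Measure (stdSimplex ℝ X)).bind D.kernel, inferInstance⟩

theorem integral_kernel (D : SteppingFamily X Y) (f : C(stdSimplex ℝ X, ℝ))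
    (α : stdSimplex ℝ X) : ∫ β, f β ∂(D.kernel α) = D.markovOperator f α := by
  rw [kernel_apply, integral_finsetSum_measure]
  · refine Finset.sum_congr rfl fun y _ => ?_
    rw [integral_smul_measure, integral_dirac, ENNReal.toReal_ofReal (D.weight_nonneg y α),
      smul_eq_mul]
  · exact fun y _ => (integrable_dirac (by simp)).smul_measure ENNReal.ofReal_ne_top

/-- `dual` is the adjoint of `markovOperator`. -/
theorem integral_dual (D : SteppingFamily X Y) (μ : ProbabilityMeasure (stdSimplex ℝ X))
    (f : C(stdSimplex ℝ X, ℝ)) :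
    ∫ β, f β ∂(D.dual μ : Measure (stdSimplex ℝ X)) =
      ∫ α, D.markovOperator f α ∂(μ : Measure (stdSimplex ℝ X)) := by
  have hb : (D.dual μ : Measure (stdSimplex ℝ X)) =
      (D.kernel ∘ₖ Kernel.const Unit (μ : Measure (stdSimplex ℝ X))) () := by
    rw [Kernel.comp_apply, Kernel.const_apply]
    rfl
  have hi : Integrable f (D.dual μ : Measure (stdSimplex ℝ X)) :=
    Integrable.of_bound f.continuous.measurable.aestronglyMeasurable ‖f‖
      (ae_of_all _ fun β => f.norm_coe_le_norm β)
  rw [hb] at hi ⊢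
  rw [Kernel.integral_comp hi, Kernel.const_apply]
  simp only [D.integral_kernel]

/-- A stationary distribution of the `α`-chain is a probability measure fixed by `T*`. -/
def IsStationary (D : SteppingFamily X Y) (μ : ProbabilityMeasure (stdSimplex ℝ X)) : Prop :=
  D.dual μ = μ

/-- The Cesàro mean `(1 / (n + 1)) ∑_{k = 0}^{n} (T*)^k μ`. -/
def cesaroMean (D : SteppingFamily X Y) (μ : ProbabilityMeasure (stdSimplex ℝ X)) (n : ℕ) :
    ProbabilityMeasure (stdSimplex ℝ X) :=
  ⟨((n + 1 : ℕ) : ℝ≥0∞)⁻¹ •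
      ∑ k ∈ Finset.range (n + 1), ((D.dual^[k] μ : ProbabilityMeasure (stdSimplex ℝ X)) :
        Measure (stdSimplex ℝ X)),
    ⟨by
      simp only [Measure.smul_apply, Measure.coe_finsetSum, Finset.sum_apply, measure_univ,
        Finset.sum_const, Finset.card_range, nsmul_eq_mul, mul_one, smul_eq_mul]
      exact ENNReal.inv_mul_cancel (by simp) (ENNReal.natCast_ne_top _)⟩⟩

end SteppingFamily

end

/-! Extend `f` from the simplex to the positive cone by `F(sα) = s f(α)`. On such extensions `T`
becomes `F ↦ ∑ y, F(x M(y))`, free of normalizations. Since `∑ y, ‖x M(y)‖₁ ≤ ‖x‖₁` for every signed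
`x`, the operator `T`, its powers and their averages preserve each class of `C`-Lipschitz
extensions, with the same `C` (`isNonexpansive_markovEnd`).

Write the rank-one matrix as `u γ`. If `W` is a word of length `l` with `cW` close to it, then `cαW`
is close to `(αu)γ` for every `α`. For `f ≥ 0`, `F(αW)` is one term of `(T^l f)(α)`, so `T^l f ≥
q((αu) f(γ) - Cη)`. The factor `αu` may vanish, but averaging over finitely many powers of `T`
replaces `u` by a strictly positive vector. The result is a Doeblin bound `B f ≥ q(κ f(γ) - Cη)`
with `κ` independent of `η` (`exists_minorization`).

Applied to `max f - f` and `f - min f`, it makes `B` lower the oscillation by at least `q(κ osc f -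
4Cη)`. Hence a uniformly cone-Lipschitz sequence whose loss of oscillation under each such `B` tends
to zero has oscillation tending to zero (`tendsto_osc_zero`). This covers `T^n f` in the primitive
case, where the oscillation is monotone, and the Cesàro means in general, as they are asymptotically
`T`-invariant. Vanishing oscillation forces the integrals against any `μ` and against a stationary
`lam` to merge. -/

namespace SteppingFamily

/-! ### Oscillation of continuous functions on a compact space -/

section Oscillation

variable {Z : Type*} [TopologicalSpace Z]

/-- The oscillation of a continuous function on a compact space. -/
noncomputable def osc (f : C(Z, ℝ)) : ℝ := ⨆ p : Z × Z, (f p.1 - f p.2)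

theorem osc_le [Nonempty Z] {f : C(Z, ℝ)} {c : ℝ} (h : ∀ x y, f x - f y ≤ c) : osc f ≤ c :=
  ciSup_le fun p => h p.1 p.2

variable [CompactSpace Z]

theorem sub_le_osc (f : C(Z, ℝ)) (x y : Z) : f x - f y ≤ osc f := by
  refine le_ciSup (f := fun p : Z × Z => f p.1 - f p.2) ⟨‖f‖ + ‖f‖, ?_⟩ (x, y)
  rintro _ ⟨p, rfl⟩
  have h1 := abs_le.1 (f.norm_coe_le_norm p.1)
  have h2 := abs_le.1 (f.norm_coe_le_norm p.2)
  dsimp only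
  linarith [h1.2, h2.1]

variable [Nonempty Z]

theorem osc_nonneg (f : C(Z, ℝ)) : 0 ≤ osc f := by
  obtain ⟨x⟩ := ‹Nonempty Z›
  simpa using sub_le_osc f x x

theorem exists_osc_eq (f : C(Z, ℝ)) :
    ∃ x y, osc f = f x - f y ∧ ∀ z, f y ≤ f z ∧ f z ≤ f x := by
  obtain ⟨x, -, hx⟩ := isCompact_univ.exists_isMaxOn Set.univ_nonempty f.continuous.continuousOn
  obtain ⟨y, -, hy⟩ := isCompact_univ.exists_isMinOn Set.univ_nonempty f.continuous.continuousOn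
  have hx' : ∀ z, f z ≤ f x := fun z => hx (Set.mem_univ z)
  have hy' : ∀ z, f y ≤ f z := fun z => hy (Set.mem_univ z)
  exact ⟨x, y, le_antisymm (osc_le fun z w => by linarith [hx' z, hy' w]) (sub_le_osc f x y),
    fun z => ⟨hy' z, hx' z⟩⟩

theorem osc_sub_le (f g : C(Z, ℝ)) : osc f - osc g ≤ 2 * ‖f - g‖ := by
  rw [sub_le_iff_le_add]
  refine osc_le fun x y => ?_
  have h1 := abs_le.1 ((f - g).norm_coe_le_norm x)
  have h2 := abs_le.1 ((f - g).norm_coe_le_norm y)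
  simp only [ContinuousMap.sub_apply] at h1 h2
  linarith [sub_le_osc g x y, h1.2, h2.1]

end Oscillation

/-! ### Cone-Lipschitz functions and the operators preserving them -/

variable {X Y : Type*} [Fintype X]

/-- The functions on the simplex whose homogeneous extension to the positive cone is
`C`-Lipschitz for the `ℓ¹` distance. -/
def IsConeLipschitz (C : ℝ) (f : C(stdSimplex ℝ X, ℝ)) : Prop :=
  ∀ s t : ℝ, 0 ≤ s → 0 ≤ t → ∀ α β : stdSimplex ℝ X,
    |s * f α - t * f β| ≤ C * ∑ j, |s * α.1 j - t * β.1 j|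

theorem abs_sub_le_sum_abs (s t : ℝ) (α β : stdSimplex ℝ X) :
    |s - t| ≤ ∑ j, |s * α.1 j - t * β.1 j| := by
  have : s - t = ∑ j, (s * α.1 j - t * β.1 j) := by
    rw [Finset.sum_sub_distrib, ← Finset.mul_sum, ← Finset.mul_sum, α.2.2, β.2.2]
    ring
  rw [this]
  exact Finset.abs_sum_le_sum_abs _ _

namespace IsConeLipschitz

theorem abs_le {C : ℝ} {f : C(stdSimplex ℝ X, ℝ)} (hf : IsConeLipschitz C f)
    (α : stdSimplex ℝ X) : |f α| ≤ C := by
  have h := hf 1 0 zero_le_one le_rfl α α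
  simp only [one_mul, zero_mul, sub_zero] at h
  rwa [Finset.sum_congr rfl fun j _ => abs_of_nonneg (α.2.1 j), α.2.2, mul_one] at h

theorem const (c : ℝ) :
    IsConeLipschitz |c| (ContinuousMap.const (stdSimplex ℝ X) c) := by
  intro s t _ _ α β
  rw [ContinuousMap.const_apply, ContinuousMap.const_apply, ← sub_mul, abs_mul, mul_comm]
  exact mul_le_mul_of_nonneg_left (abs_sub_le_sum_abs s t α β) (abs_nonneg c)

theorem sub {C C' : ℝ} {f g : C(stdSimplex ℝ X, ℝ)} (hf : IsConeLipschitz C f)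
    (hg : IsConeLipschitz C' g) : IsConeLipschitz (C + C') (f - g) := by
  intro s t hs ht α β
  have h : s * (f - g) α - t * (f - g) β = (s * f α - t * f β) - (s * g α - t * g β) := by
    simp only [ContinuousMap.sub_apply]; ring
  rw [h, add_mul]
  exact (abs_sub _ _).trans (add_le_add (hf s t hs ht α β) (hg s t hs ht α β))

theorem mono {C C' : ℝ} {f : C(stdSimplex ℝ X, ℝ)} (hf : IsConeLipschitz C f) (h : C ≤ C') :
    IsConeLipschitz C' f := fun s t hs ht α β =>
  (hf s t hs ht α β).trans
    (mul_le_mul_of_nonneg_right h (Finset.sum_nonneg fun _ _ => abs_nonneg _))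

theorem smul {C : ℝ} {f : C(stdSimplex ℝ X, ℝ)} (hf : IsConeLipschitz C f) {c : ℝ}
    (hc : 0 ≤ c) : IsConeLipschitz (c * C) (c • f) := by
  intro s t hs ht α β
  have h : s * (c • f) α - t * (c • f) β = c * (s * f α - t * f β) := by
    simp only [ContinuousMap.smul_apply, smul_eq_mul]; ring
  rw [h, abs_mul, abs_of_nonneg hc, mul_assoc]
  exact mul_le_mul_of_nonneg_left (hf s t hs ht α β) hc

theorem sum {ι : Type*} {C : ℝ} (K : Finset ι) {f : ι → C(stdSimplex ℝ X, ℝ)}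
    (hf : ∀ k ∈ K, IsConeLipschitz C (f k)) :
    IsConeLipschitz (K.card * C) (∑ k ∈ K, f k) := by
  intro s t hs ht α β
  have h : s * (∑ k ∈ K, f k) α - t * (∑ k ∈ K, f k) β
      = ∑ k ∈ K, (s * f k α - t * f k β) := by
    simp only [ContinuousMap.coe_sum, Finset.sum_apply, Finset.mul_sum, Finset.sum_sub_distrib]
  rw [h, mul_assoc, ← nsmul_eq_mul]
  exact (Finset.abs_sum_le_sum_abs _ _).trans
    (Finset.sum_le_card_nsmul _ _ _ fun k hk => hf k hk s t hs ht α β)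

end IsConeLipschitz

/-- Lipschitz functions determine weak convergence, so the cone-Lipschitz classes are rich enough
for the theorem. -/
theorem exists_isConeLipschitz {L : NNReal} {f : C(stdSimplex ℝ X, ℝ)} (hf : LipschitzWith L f) :
    ∃ C, IsConeLipschitz C f := by
  refine ⟨2 * L + ‖f‖, fun s t hs ht α β => ?_⟩
  have h : s * f α - t * f β = s * (f α - f β) + (s - t) * f β := by ring
  set S := ∑ j, |s * α.1 j - t * β.1 j| with hS
  have hst : |s - t| ≤ S := abs_sub_le_sum_abs s t α β
  have hS0 : 0 ≤ S := (abs_nonneg _).trans hst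
  -- From `s(α - β) = (sα - tβ) + (t - s)β`, where each summand has sup norm at most `S`.
  have hd : s * dist α β ≤ 2 * S := by
    rw [Subtype.dist_eq, ← abs_of_nonneg hs, ← Real.norm_eq_abs, dist_eq_norm, ← norm_smul,
      pi_norm_le_iff_of_nonneg (by positivity)]
    intro j
    have e : (s • (α.1 - β.1)) j = (s * α.1 j - t * β.1 j) + (t - s) * β.1 j := by
      simp only [Pi.smul_apply, Pi.sub_apply, smul_eq_mul]; ring
    have h1 : |s * α.1 j - t * β.1 j| ≤ S :=
      Finset.single_le_sum (f := fun j => |s * α.1 j - t * β.1 j|)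
        (fun _ _ => abs_nonneg _) (Finset.mem_univ j)
    have h2 : |(t - s) * β.1 j| ≤ S := by
      rw [abs_mul, abs_sub_comm, abs_of_nonneg (β.2.1 j)]
      have hb : β.1 j ≤ 1 := by
        rw [← β.2.2]
        exact Finset.single_le_sum (fun i _ => β.2.1 i) (Finset.mem_univ j)
      exact (mul_le_of_le_one_right (abs_nonneg _) hb).trans hst
    rw [e, Real.norm_eq_abs]
    exact (abs_add_le _ _).trans (by linarith)
  have h3 : |s * (f α - f β)| ≤ 2 * L * S := by
    rw [abs_mul, abs_of_nonneg hs, ← Real.dist_eq]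
    have := mul_le_mul_of_nonneg_left (hf.dist_le_mul α β) hs
    have h4 := mul_le_mul_of_nonneg_left hd L.2
    calc _ ≤ _ := this
      _ = (L : ℝ) * (s * dist α β) := by ring
      _ ≤ (L : ℝ) * (2 * S) := h4
      _ = _ := by ring
  have h5 : |(s - t) * f β| ≤ ‖f‖ * S := by
    rw [abs_mul, mul_comm]
    exact mul_le_mul (f.norm_coe_le_norm β) hst (abs_nonneg _) (norm_nonneg _)
  rw [h, add_mul]
  exact (abs_add_le _ _).trans (add_le_add h3 h5)

/-- Positive unital operators on `C(Δ)` that preserve every class of cone-Lipschitz functions. -/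
structure IsNonexpansive (B : Module.End ℝ C(stdSimplex ℝ X, ℝ)) : Prop where
  nonneg : ∀ f, (∀ α, 0 ≤ f α) → ∀ α, 0 ≤ B f α
  const : ∀ c, B (ContinuousMap.const _ c) = ContinuousMap.const _ c
  coneLipschitz : ∀ C f, IsConeLipschitz C f → IsConeLipschitz C (B f)

namespace IsNonexpansive

variable {A B : Module.End ℝ C(stdSimplex ℝ X, ℝ)}

theorem one : IsNonexpansive (1 : Module.End ℝ C(stdSimplex ℝ X, ℝ)) :=
  ⟨fun _ h => h, fun _ => rfl, fun _ _ h => h⟩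

theorem mul (hA : IsNonexpansive A) (hB : IsNonexpansive B) : IsNonexpansive (A * B) where
  nonneg f h := hA.nonneg _ (hB.nonneg f h)
  const c := by rw [Module.End.mul_apply, hB.const, hA.const]
  coneLipschitz C f h := hA.coneLipschitz C _ (hB.coneLipschitz C f h)

theorem pow (hB : IsNonexpansive B) (n : ℕ) : IsNonexpansive (B ^ n) := by
  induction n with
  | zero => exact one
  | succ n ih => rw [pow_succ]; exact ih.mul hB

theorem mono (hB : IsNonexpansive B) {f g : C(stdSimplex ℝ X, ℝ)} (h : ∀ α, f α ≤ g α)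
    (α : stdSimplex ℝ X) : B f α ≤ B g α := by
  have := hB.nonneg (g - f) (fun β => by simpa using h β) α
  simpa using this

theorem le_const (hB : IsNonexpansive B) {f : C(stdSimplex ℝ X, ℝ)} {c : ℝ} (h : ∀ α, f α ≤ c)
    (α : stdSimplex ℝ X) : B f α ≤ c := by
  simpa [hB.const] using hB.mono (g := ContinuousMap.const _ c) h α

theorem const_le (hB : IsNonexpansive B) {f : C(stdSimplex ℝ X, ℝ)} {c : ℝ} (h : ∀ α, c ≤ f α)
    (α : stdSimplex ℝ X) : c ≤ B f α := by
  simpa [hB.const] using hB.mono (f := ContinuousMap.const _ c) h α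

theorem norm_le (hB : IsNonexpansive B) (f : C(stdSimplex ℝ X, ℝ)) : ‖B f‖ ≤ ‖f‖ := by
  refine (ContinuousMap.norm_le _ (norm_nonneg f)).2 fun α => _root_.abs_le.2 ⟨?_, ?_⟩
  · exact hB.const_le (fun β => (_root_.abs_le.1 (f.norm_coe_le_norm β)).1) α
  · exact hB.le_const (fun β => (_root_.abs_le.1 (f.norm_coe_le_norm β)).2) α

theorem osc_le [Nonempty X] (hB : IsNonexpansive B) (f : C(stdSimplex ℝ X, ℝ)) :
    osc (B f) ≤ osc f := by
  obtain ⟨x, y, h, hz⟩ := exists_osc_eq f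
  rw [h]
  exact SteppingFamily.osc_le fun α β => by
    linarith [hB.le_const (fun z => (hz z).2) α, hB.const_le (fun z => (hz z).1) β]

theorem tendsto_zero (hB : IsNonexpansive B) {ι : Type*} {l : Filter ι}
    {f : ι → C(stdSimplex ℝ X, ℝ)} (hf : Tendsto f l (𝓝 0)) :
    Tendsto (fun i => B (f i)) l (𝓝 0) :=
  squeeze_zero_norm (fun i => hB.norm_le (f i)) (by simpa using hf.norm)

theorem average {K : Finset ℕ} (hK : K.Nonempty) {A : ℕ → Module.End ℝ C(stdSimplex ℝ X, ℝ)}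
    (hA : ∀ k, IsNonexpansive (A k)) :
    IsNonexpansive ((K.card : ℝ)⁻¹ • ∑ k ∈ K, A k) := by
  have hc : (K.card : ℝ) ≠ 0 := by simpa using hK.ne_empty
  refine ⟨fun f h α => ?_, fun c => ?_, fun C f h => ?_⟩
  · simp only [LinearMap.smul_apply, LinearMap.sum_apply, ContinuousMap.smul_apply,
      ContinuousMap.coe_sum, Finset.sum_apply, smul_eq_mul]
    exact mul_nonneg (by positivity) (Finset.sum_nonneg fun k _ => (hA k).nonneg f h α)
  · rw [LinearMap.smul_apply, LinearMap.sum_apply, Finset.sum_congr rfl fun k _ => (hA k).const c,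
      Finset.sum_const, ← Nat.cast_smul_eq_nsmul ℝ, inv_smul_smul₀ hc]
  · have h1 := (IsConeLipschitz.sum K fun k _ => (hA k).coneLipschitz C f h).smul
      (c := (K.card : ℝ)⁻¹) (by positivity)
    rw [inv_mul_cancel_left₀ hc] at h1
    simpa only [LinearMap.smul_apply, LinearMap.sum_apply] using h1

end IsNonexpansive

/-! ### The Markov operator on homogeneous extensions -/

variable [DecidableEq X] [Fintype Y]

/-- The Markov operator as a linear endomorphism of `C(Δ)`. -/
noncomputable def markovEnd (D : SteppingFamily X Y) : Module.End ℝ C(stdSimplex ℝ X, ℝ) where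
  toFun := D.markovOperator
  map_add' f g := by
    ext α
    simp only [markovOperator, ContinuousMap.coe_mk, ContinuousMap.add_apply, mul_add,
      Finset.sum_add_distrib]
  map_smul' c f := by
    ext α
    simp only [markovOperator, ContinuousMap.coe_mk, ContinuousMap.smul_apply, smul_eq_mul,
      Finset.mul_sum, RingHom.id_apply]
    exact Finset.sum_congr rfl fun y _ => by ring

theorem markovEnd_apply (D : SteppingFamily X Y) (f : C(stdSimplex ℝ X, ℝ))
    (α : stdSimplex ℝ X) : D.markovEnd f α = ∑ y, D.weight y α * f (D.step y α) := rfl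

/-- At zero weight the nonnegative vector `α M(y)` has sum zero, hence vanishes; the default value
in `step` therefore plays no role. -/
theorem weight_mul_step (D : SteppingFamily X Y) (y : Y) (α : stdSimplex ℝ X) (j : X) :
    D.weight y α * (D.step y α).1 j = (α.1 ᵥ* D.mat y) j := by
  by_cases h : D.weight y α = 0
  · rw [h, zero_mul]
    exact ((Finset.sum_eq_zero_iff_of_nonneg fun j _ => D.vecMul_nonneg y α j).1 h j
      (Finset.mem_univ j)).symm
  · rw [D.coe_step h, Pi.smul_apply, smul_eq_mul, mul_inv_cancel_left₀ h]

theorem sum_sum_mat (D : SteppingFamily X Y) (i : X) : ∑ y, ∑ j, D.mat y i j = 1 := by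
  rw [Finset.sum_comm]
  simpa only [Matrix.sum_apply] using (Matrix.mem_rowStochastic_iff_sum.1 D.sum_mem).2 i

theorem sum_sum_abs_vecMul_le (D : SteppingFamily X Y) (x : X → ℝ) :
    ∑ y, ∑ j, |(x ᵥ* D.mat y) j| ≤ ∑ i, |x i| := by
  calc ∑ y, ∑ j, |(x ᵥ* D.mat y) j| ≤ ∑ y, ∑ j, ∑ i, |x i| * D.mat y i j := by
        refine Finset.sum_le_sum fun y _ => Finset.sum_le_sum fun j _ => ?_
        refine (Finset.abs_sum_le_sum_abs _ _).trans (Finset.sum_le_sum fun i _ => ?_)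
        rw [abs_mul, abs_of_nonneg (D.mat_nonneg y i j)]
    _ = ∑ y, ∑ i, ∑ j, |x i| * D.mat y i j :=
        Finset.sum_congr rfl fun y _ => Finset.sum_comm
    _ = ∑ i, |x i| * ∑ y, ∑ j, D.mat y i j := by
        rw [Finset.sum_comm]
        simp only [Finset.mul_sum]
    _ = ∑ i, |x i| := by simp only [D.sum_sum_mat, mul_one]

/-- On homogeneous extensions the operator is `F ↦ ∑ y, F(x M(y))`; the Lipschitz constant survives
because the rows of `∑ y, M(y)` sum to one, which bounds the total `ℓ¹` norm of the vectors `x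
M(y)`. -/
theorem isNonexpansive_markovEnd (D : SteppingFamily X Y) : IsNonexpansive D.markovEnd where
  nonneg f h α := Finset.sum_nonneg fun y _ => mul_nonneg (D.weight_nonneg y α) (h _)
  const c := by
    ext α
    simp only [markovEnd_apply, ContinuousMap.const_apply, ← Finset.sum_mul, D.sum_weight,
      one_mul]
  coneLipschitz C f hf := by
    intro s t hs ht α β
    have hC : 0 ≤ C := (abs_nonneg _).trans (hf.abs_le α)
    have e : s * D.markovEnd f α - t * D.markovEnd f β
        = ∑ y, (s * D.weight y α * f (D.step y α) - t * D.weight y β * f (D.step y β)) := by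
      simp only [markovEnd_apply, Finset.mul_sum, Finset.sum_sub_distrib, mul_assoc]
    rw [e]
    calc _ ≤ ∑ y, C * ∑ j, |((fun i => s * α.1 i - t * β.1 i) ᵥ* D.mat y) j| := by
          refine (Finset.abs_sum_le_sum_abs _ _).trans (Finset.sum_le_sum fun y _ => ?_)
          refine (hf _ _ (mul_nonneg hs (D.weight_nonneg y α))
            (mul_nonneg ht (D.weight_nonneg y β)) _ _).trans_eq ?_
          congr 1
          refine Finset.sum_congr rfl fun j _ => ?_
          rw [mul_assoc, weight_mul_step, mul_assoc, weight_mul_step]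
          simp only [Matrix.vecMul, dotProduct, sub_mul, Finset.sum_sub_distrib, Finset.mul_sum,
            mul_assoc]
      _ = C * ∑ y, ∑ j, |((fun i => s * α.1 i - t * β.1 i) ᵥ* D.mat y) j| := by
          rw [Finset.mul_sum]
      _ ≤ _ := mul_le_mul_of_nonneg_left (D.sum_sum_abs_vecMul_le _) hC

end SteppingFamily

/-! ### Rank-one limits and the Doeblin minorization -/

namespace SteppingFamily

section RankOne

theorem mul_eq_mul_of_rank_eq_one {X : Type*} [Fintype X] [DecidableEq X] {R : Matrix X X ℝ}
    (h : R.rank = 1) (i j k l : X) : R i j * R k l = R i l * R k j := by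
  obtain ⟨v, -, hv⟩ := finrank_eq_one_iff'.1 h
  have hcol : ∀ j, ∃ c : ℝ, ∀ i, R i j = c * v.1 i := fun j => by
    obtain ⟨c, hc⟩ := hv ⟨R.mulVecLin (Pi.single j 1), LinearMap.mem_range_self _ _⟩
    refine ⟨c, fun i => ?_⟩
    have := congrFun (congrArg Subtype.val hc) i
    simpa using this.symm
  choose c hc using hcol
  rw [hc j i, hc l k, hc l i, hc j k]
  ring

/-- Take `γ` to be a nonzero row, normalized, and `u` the vector of row sums; the vanishing of all
2×2 minors gives the factorization. -/
theorem exists_eq_vecMulVec_of_rank_eq_one {X : Type*} [Fintype X] [DecidableEq X]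
    {R : Matrix X X ℝ} (h : R.rank = 1) (h0 : ∀ i j, 0 ≤ R i j) :
    ∃ (u : X → ℝ) (γ : stdSimplex ℝ X), (∀ i, 0 ≤ u i) ∧ (∃ i, 0 < u i) ∧
      ∀ i j, R i j = u i * γ.1 j := by
  have hR : ∃ i j, R i j ≠ 0 := by
    by_contra! hz
    have : R = 0 := by ext i j; exact hz i j
    simp [this] at h
  obtain ⟨k, l, hkl⟩ := hR
  have hS : 0 < ∑ j, R k j := Finset.sum_pos' (fun j _ => h0 k j)
    ⟨l, Finset.mem_univ l, lt_of_le_of_ne (h0 k l) hkl.symm⟩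
  refine ⟨fun i => ∑ j, R i j, ⟨fun j => R k j / ∑ j, R k j, fun j => div_nonneg (h0 k j) hS.le, ?_⟩,
    fun i => Finset.sum_nonneg fun j _ => h0 i j, ⟨k, hS⟩, fun i j => ?_⟩
  · rw [← Finset.sum_div, div_self hS.ne']
  · dsimp only
    rw [← mul_div_assoc, eq_div_iff hS.ne', Finset.mul_sum, Finset.sum_mul]
    exact Finset.sum_congr rfl fun m _ => mul_eq_mul_of_rank_eq_one h i j k m

end RankOne

variable {X Y : Type*} [Fintype X]

/-- The function `α ↦ α u` on the simplex. -/
noncomputable def pairing (u : X → ℝ) : C(stdSimplex ℝ X, ℝ) where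
  toFun α := α.1 ⬝ᵥ u
  continuous_toFun := continuous_subtype_val.dotProduct continuous_const

theorem pairing_apply (u : X → ℝ) (α : stdSimplex ℝ X) : pairing u α = α.1 ⬝ᵥ u := rfl

variable [DecidableEq X] [Fintype Y]

/-- The state reached from `α` after the outputs `ys`. -/
noncomputable def walk (D : SteppingFamily X Y) : List Y → stdSimplex ℝ X → stdSimplex ℝ X
  | [], α => α
  | y :: ys, α => D.walk ys (D.step y α)

/-- The probability of the outputs `ys` from the state `α`. -/
noncomputable def wordWeight (D : SteppingFamily X Y) : List Y → stdSimplex ℝ X → ℝ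
  | [], _ => 1
  | y :: ys, α => D.weight y α * D.wordWeight ys (D.step y α)

theorem wordWeight_nonneg (D : SteppingFamily X Y) (ys : List Y) (α : stdSimplex ℝ X) :
    0 ≤ D.wordWeight ys α := by
  induction ys generalizing α with
  | nil => exact zero_le_one
  | cons y ys ih => exact mul_nonneg (D.weight_nonneg y α) (ih _)

/-- The normalizing factors telescope along the word, so only the matrix product remains. -/
theorem wordWeight_mul_walk (D : SteppingFamily X Y) (ys : List Y) (α : stdSimplex ℝ X) (j : X) :
    D.wordWeight ys α * (D.walk ys α).1 j = (α.1 ᵥ* (ys.map D.mat).prod) j := by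
  induction ys generalizing α with
  | nil => simp [wordWeight, walk]
  | cons y ys ih =>
    rw [wordWeight, walk, mul_assoc, ih, List.map_cons, List.prod_cons, ← Matrix.vecMul_vecMul]
    simp only [Matrix.vecMul, dotProduct, Finset.mul_sum, ← mul_assoc]
    refine Finset.sum_congr rfl fun i _ => ?_
    rw [weight_mul_step]
    rfl

/-- One path is kept in the expansion of the power over all words; the others contribute
nonnegatively. -/
theorem wordWeight_mul_le (D : SteppingFamily X Y) {f : C(stdSimplex ℝ X, ℝ)}
    (hf : ∀ α, 0 ≤ f α) (ys : List Y) (α : stdSimplex ℝ X) :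
    D.wordWeight ys α * f (D.walk ys α) ≤ (D.markovEnd ^ ys.length) f α := by
  induction ys generalizing α with
  | nil => simp [wordWeight, walk]
  | cons y ys ih =>
    rw [List.length_cons, pow_succ', Module.End.mul_apply, markovEnd_apply, wordWeight, walk,
      mul_assoc]
    refine (mul_le_mul_of_nonneg_left (ih _) (D.weight_nonneg y α)).trans ?_
    exact Finset.single_le_sum (f := fun y => D.weight y α *
      (D.markovEnd ^ ys.length) f (D.step y α)) (fun z _ => mul_nonneg (D.weight_nonneg z α)
        ((D.isNonexpansive_markovEnd.pow _).nonneg f hf _)) (Finset.mem_univ y)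

/-- A linear function is its own homogeneous extension, and `∑ y, (α M(y)) u = α (M u)`. This is how
irreducibility of the hidden chain enters. -/
theorem markovEnd_pairing (D : SteppingFamily X Y) (u : X → ℝ) :
    D.markovEnd (pairing u) = pairing (D.trans *ᵥ u) := by
  ext α
  rw [markovEnd_apply, pairing_apply, Matrix.dotProduct_mulVec, trans, Matrix.vecMul_sum,
    sum_dotProduct]
  refine Finset.sum_congr rfl fun y _ => ?_
  simp only [pairing_apply, dotProduct, Finset.mul_sum, ← mul_assoc, weight_mul_step]

theorem markovEnd_pow_pairing (D : SteppingFamily X Y) (u : X → ℝ) (k : ℕ) :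
    (D.markovEnd ^ k) (pairing u) = pairing (D.trans ^ k *ᵥ u) := by
  induction k with
  | zero => simp
  | succ k ih =>
    rw [pow_succ', Module.End.mul_apply, ih, markovEnd_pairing, Matrix.mulVec_mulVec, ← pow_succ']

theorem nonneg_of_mem_words (D : SteppingFamily X Y) {W : Matrix X X ℝ} (hW : W ∈ D.words)
    (i j : X) : 0 ≤ W i j := by
  obtain ⟨ys, rfl⟩ := hW
  dsimp only
  induction ys generalizing i j with
  | nil =>
    rw [List.map_nil, List.prod_nil, Matrix.one_apply]
    split_ifs <;> norm_num
  | cons y ys ih =>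
    rw [List.map_cons, List.prod_cons, Matrix.mul_apply]
    exact Finset.sum_nonneg fun k _ => mul_nonneg (D.mat_nonneg y i k) (ih k j)

theorem nonneg_of_mem_closure_cone (D : SteppingFamily X Y) {R : Matrix X X ℝ}
    (hR : R ∈ closure D.cone) (i j : X) : 0 ≤ R i j := by
  have hc : IsClosed {A : Matrix X X ℝ | 0 ≤ A i j} :=
    isClosed_le continuous_const (continuous_id.matrix_elem i j)
  refine closure_minimal (fun A hA => ?_) hc hR
  obtain ⟨c, hc, W, hW, rfl⟩ := hA
  exact mul_nonneg hc.le (D.nonneg_of_mem_words hW i j)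

theorem exists_word_near (D : SteppingFamily X Y) {R : Matrix X X ℝ} (hR : R ∈ closure D.cone)
    {η : ℝ} (hη : 0 < η) :
    ∃ (ys : List Y) (c : ℝ), 0 < c ∧ ∀ i, ∑ j, |c * (ys.map D.mat).prod i j - R i j| ≤ η := by
  have ho : IsOpen {A : Matrix X X ℝ | ∑ i, ∑ j, |A i j - R i j| < η} := by
    refine isOpen_lt ?_ continuous_const
    exact continuous_finsetSum _ fun i _ => continuous_finsetSum _ fun j _ =>
      ((continuous_id.matrix_elem i j).sub continuous_const).abs
  obtain ⟨A, hA, c, hc, W, ⟨ys, rfl⟩, rfl⟩ :=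
    mem_closure_iff.1 hR _ ho (by simpa using hη)
  refine ⟨ys, c, hc, fun i => ?_⟩
  refine le_trans ?_ (le_of_lt hA)
  exact Finset.single_le_sum
    (f := fun i => ∑ j, |(c • (ys.map D.mat).prod) i j - R i j|)
    (fun _ _ => Finset.sum_nonneg fun _ _ => abs_nonneg _) (Finset.mem_univ i)

/-- Here `q = c⁻¹` and `l` is the length of a word `W` with `cW` within `η` of `R`. Both depend on
`η`, but the coefficient of `f γ` inside the bracket does not. -/
theorem exists_pairing_minorization (D : SteppingFamily X Y) {R : Matrix X X ℝ}
    (hR : R ∈ closure D.cone) {u : X → ℝ} {γ : stdSimplex ℝ X} (hu : ∀ i, 0 ≤ u i)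
    (huγ : ∀ i j, R i j = u i * γ.1 j) {η : ℝ} (hη : 0 < η) :
    ∃ (l : ℕ) (q : ℝ), 0 < q ∧ ∀ C f, IsConeLipschitz C f → (∀ α, 0 ≤ f α) → ∀ α,
      q * (pairing u α * f γ - C * η) ≤ (D.markovEnd ^ l) f α := by
  obtain ⟨ys, c, hc, hW⟩ := D.exists_word_near hR hη
  refine ⟨ys.length, c⁻¹, inv_pos.2 hc, fun C f hf h0 α => ?_⟩
  have hC : 0 ≤ C := (abs_nonneg _).trans (hf.abs_le α)
  have hdist : ∑ j, |c * D.wordWeight ys α * (D.walk ys α).1 j - pairing u α * γ.1 j| ≤ η := by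
    calc _ ≤ ∑ j, ∑ i, α.1 i * |c * (ys.map D.mat).prod i j - R i j| := by
          refine Finset.sum_le_sum fun j _ => ?_
          have e : c * D.wordWeight ys α * (D.walk ys α).1 j - pairing u α * γ.1 j
              = ∑ i, α.1 i * (c * (ys.map D.mat).prod i j - R i j) := by
            rw [mul_assoc, wordWeight_mul_walk, pairing_apply]
            simp only [Matrix.vecMul, dotProduct, Finset.mul_sum, Finset.sum_mul, mul_sub,
              Finset.sum_sub_distrib, huγ]
            congr 1 <;> exact Finset.sum_congr rfl fun i _ => by ring
          rw [e]
          refine (Finset.abs_sum_le_sum_abs _ _).trans_eq (Finset.sum_congr rfl fun i _ => ?_)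
          rw [abs_mul, abs_of_nonneg (α.2.1 i)]
      _ = ∑ i, α.1 i * ∑ j, |c * (ys.map D.mat).prod i j - R i j| := by
          rw [Finset.sum_comm]
          simp only [Finset.mul_sum]
      _ ≤ ∑ i, α.1 i * η :=
          Finset.sum_le_sum fun i _ => mul_le_mul_of_nonneg_left (hW i) (α.2.1 i)
      _ = η := by rw [← Finset.sum_mul, α.2.2, one_mul]
  have hp : 0 ≤ pairing u α := Finset.sum_nonneg fun i _ => mul_nonneg (α.2.1 i) (hu i)
  -- The two scales `c * wordWeight` and `αu` differ in general, which is why the Lipschitz bound is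
  -- needed on the cone and not only on the simplex.
  have h1 := (abs_le.1 ((hf _ _ (mul_nonneg hc.le (D.wordWeight_nonneg ys α)) hp
    (D.walk ys α) γ).trans (mul_le_mul_of_nonneg_left hdist hC))).1
  have h2 := mul_le_mul_of_nonneg_left (D.wordWeight_mul_le h0 ys α) hc.le
  rw [inv_mul_le_iff₀ hc]
  linarith

/-- The average of the powers `T ^ (k + l)` of the Markov operator over the exponents `k ∈ K`. -/
noncomputable def powAverage (D : SteppingFamily X Y) (K : Finset ℕ) (l : ℕ) :
    Module.End ℝ C(stdSimplex ℝ X, ℝ) :=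
  (K.card : ℝ)⁻¹ • ∑ k ∈ K, D.markovEnd ^ (k + l)

theorem isNonexpansive_powAverage (D : SteppingFamily X Y) {K : Finset ℕ} (hK : K.Nonempty)
    (l : ℕ) : IsNonexpansive (D.powAverage K l) :=
  .average hK fun k => D.isNonexpansive_markovEnd.pow (k + l)

theorem powAverage_eq_mul (D : SteppingFamily X Y) (K : Finset ℕ) (l : ℕ) :
    D.powAverage K l = D.powAverage K 0 * D.markovEnd ^ l := by
  simp only [powAverage, add_zero, smul_mul_assoc, Finset.sum_mul, pow_add]

theorem powAverage_pairing_apply (D : SteppingFamily X Y) (K : Finset ℕ) (u : X → ℝ)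
    (α : stdSimplex ℝ X) :
    D.powAverage K 0 (pairing u) α =
      (K.card : ℝ)⁻¹ * ∑ i, α.1 i * ∑ j, (∑ k ∈ K, (D.trans ^ k) i j) * u j := by
  simp only [powAverage, add_zero, LinearMap.smul_apply, LinearMap.sum_apply,
    ContinuousMap.smul_apply, ContinuousMap.coe_sum, Finset.sum_apply, smul_eq_mul,
    markovEnd_pow_pairing, pairing_apply]
  congr 1
  simp only [dotProduct, Matrix.mulVec]
  rw [Finset.sum_comm]
  refine Finset.sum_congr rfl fun i _ => ?_
  rw [← Finset.mul_sum, Finset.sum_comm]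
  simp only [Finset.sum_mul]

/-- Doeblin-type minorization: some averages of powers of the Markov operator put, up to an
arbitrarily small relative error `η`, a mass proportional to `q` on one fixed state `γ`. -/
theorem exists_minorization (D : SteppingFamily X Y)
    (hrank : ∃ R ∈ closure D.cone, R.rank = 1) {K : Finset ℕ} (hK : K.Nonempty)
    (hpos : ∀ i j, 0 < ∑ k ∈ K, (D.trans ^ k) i j) :
    ∃ (γ : stdSimplex ℝ X) (κ : ℝ), 0 < κ ∧ ∀ η, 0 < η → ∃ (l : ℕ) (q : ℝ), 0 < q ∧
      ∀ C f, IsConeLipschitz C f → (∀ α, 0 ≤ f α) → ∀ α,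
        q * (κ * f γ - C * η) ≤ D.powAverage K l f α := by
  obtain ⟨R, hR, hr⟩ := hrank
  obtain ⟨u, γ, hu, ⟨i₀, hi₀⟩, huγ⟩ :=
    exists_eq_vecMulVec_of_rank_eq_one hr (D.nonneg_of_mem_closure_cone hR)
  have : Nonempty X := ⟨i₀⟩
  have hd : ∀ i, 0 < ∑ j, (∑ k ∈ K, (D.trans ^ k) i j) * u j := fun i =>
    Finset.sum_pos' (fun j _ => mul_nonneg (hpos i j).le (hu j))
      ⟨i₀, Finset.mem_univ _, mul_pos (hpos i i₀) hi₀⟩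
  obtain ⟨m, hm⟩ := Finite.exists_min fun i => ∑ j, (∑ k ∈ K, (D.trans ^ k) i j) * u j
  have hcard : 0 < (K.card : ℝ) := by exact_mod_cast hK.card_pos
  -- The least entry of the averaged vector `M^k u`, `k ∈ K`, fixed before `η` is chosen.
  set κ := (K.card : ℝ)⁻¹ * ∑ j, (∑ k ∈ K, (D.trans ^ k) m j) * u j with hκ
  have hp : ∀ α, κ ≤ D.powAverage K 0 (pairing u) α := fun α => by
    rw [powAverage_pairing_apply, hκ]
    refine mul_le_mul_of_nonneg_left ?_ (inv_nonneg.2 hcard.le)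
    calc _ = ∑ i, α.1 i * ∑ j, (∑ k ∈ K, (D.trans ^ k) m j) * u j := by
          rw [← Finset.sum_mul, α.2.2, one_mul]
      _ ≤ _ := Finset.sum_le_sum fun i _ => mul_le_mul_of_nonneg_left (hm i) (α.2.1 i)
  refine ⟨γ, κ, mul_pos (inv_pos.2 hcard) (hd m), fun η hη => ?_⟩
  obtain ⟨l, q, hq, H⟩ := D.exists_pairing_minorization hR hu huγ hη
  refine ⟨l, q, hq, fun C f hf h0 α => ?_⟩
  have hB := D.isNonexpansive_powAverage hK 0
  have h1 := hB.mono
    (f := (q * f γ) • pairing u - ContinuousMap.const _ (q * (C * η)))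
    (g := (D.markovEnd ^ l) f) (fun β => by
      refine le_trans (le_of_eq ?_) (H C f hf h0 β)
      simp only [ContinuousMap.sub_apply, ContinuousMap.smul_apply, ContinuousMap.const_apply,
        smul_eq_mul]
      ring) α
  rw [powAverage_eq_mul, Module.End.mul_apply]
  refine le_trans ?_ h1
  simp only [map_sub, map_smul, hB.const, ContinuousMap.sub_apply, ContinuousMap.smul_apply,
    ContinuousMap.const_apply, smul_eq_mul]
  have := mul_le_mul_of_nonneg_left (hp α) (mul_nonneg hq.le (h0 γ))
  linarith

end SteppingFamily

/-! ### Decay of oscillation and weak convergence -/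

namespace SteppingFamily

variable {X Y : Type*} [Fintype X]

/-- Adding the minorizations of `max f - f` and `f - min f` cancels the unknown value `f γ`. Each of
these functions has cone-Lipschitz constant `2C`, whence `4C`. -/
theorem mul_osc_le_of_minorization [Nonempty X] {B : Module.End ℝ C(stdSimplex ℝ X, ℝ)}
    {γ : stdSimplex ℝ X} {q κ η : ℝ} (hB : IsNonexpansive B)
    (H : ∀ C f, IsConeLipschitz C f → (∀ α, 0 ≤ f α) → ∀ α, q * (κ * f γ - C * η) ≤ B f α)
    {C : ℝ} {f : C(stdSimplex ℝ X, ℝ)} (hf : IsConeLipschitz C f) :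
    q * (κ * osc f) ≤ osc f - osc (B f) + q * (4 * C * η) := by
  obtain ⟨x, y, h, hz⟩ := exists_osc_eq f
  obtain ⟨x', y', h', -⟩ := exists_osc_eq (B f)
  have hconst : ∀ α, IsConeLipschitz C (ContinuousMap.const (stdSimplex ℝ X) (f α)) :=
    fun α => (IsConeLipschitz.const (f α)).mono (hf.abs_le α)
  have h1 := H _ _ ((hconst x).sub hf) (fun α => by simpa using (hz α).2) x'
  have h2 := H _ _ (hf.sub (hconst y)) (fun α => by simpa using (hz α).1) y'
  simp only [map_sub, hB.const, ContinuousMap.sub_apply, ContinuousMap.const_apply] at h1 h2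
  rw [h', h]
  linarith

theorem integrable_continuousMap (μ : ProbabilityMeasure (stdSimplex ℝ X))
    (f : C(stdSimplex ℝ X, ℝ)) : Integrable f (μ : Measure (stdSimplex ℝ X)) :=
  Integrable.of_bound f.continuous.measurable.aestronglyMeasurable ‖f‖
    (ae_of_all _ fun β => f.norm_coe_le_norm β)

theorem tendsto_of_forall_continuousMap {ι : Type*} {l : Filter ι}
    {μ : ι → ProbabilityMeasure (stdSimplex ℝ X)} {ν : ProbabilityMeasure (stdSimplex ℝ X)}
    (h : ∀ f : C(stdSimplex ℝ X, ℝ), Tendsto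
      (fun i => ∫ α, f α ∂(μ i : Measure (stdSimplex ℝ X))) l (𝓝 (∫ α, f α ∂(ν : Measure _)))) :
    Tendsto μ l (𝓝 ν) :=
  ProbabilityMeasure.tendsto_iff_forall_integral_tendsto.2 fun f => h f.toContinuousMap

theorem tendsto_integral_continuousMap {ι : Type*} {l : Filter ι}
    {μ : ι → ProbabilityMeasure (stdSimplex ℝ X)} {ν : ProbabilityMeasure (stdSimplex ℝ X)}
    (h : Tendsto μ l (𝓝 ν)) (f : C(stdSimplex ℝ X, ℝ)) : Tendsto
      (fun i => ∫ α, f α ∂(μ i : Measure (stdSimplex ℝ X))) l (𝓝 (∫ α, f α ∂(ν : Measure _))) :=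
  ProbabilityMeasure.tendsto_iff_forall_integral_tendsto.1 h (BoundedContinuousFunction.mkOfCompact f)

theorem abs_integral_sub_integral_le_osc [Nonempty X] (μ ν : ProbabilityMeasure (stdSimplex ℝ X))
    (f : C(stdSimplex ℝ X, ℝ)) :
    |∫ α, f α ∂(μ : Measure (stdSimplex ℝ X)) - ∫ α, f α ∂(ν : Measure (stdSimplex ℝ X))|
      ≤ osc f := by
  obtain ⟨x, y, h, hz⟩ := exists_osc_eq f
  have key : ∀ ρ : ProbabilityMeasure (stdSimplex ℝ X),
      f y ≤ ∫ α, f α ∂(ρ : Measure (stdSimplex ℝ X)) ∧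
        ∫ α, f α ∂(ρ : Measure (stdSimplex ℝ X)) ≤ f x := fun ρ => by
    have h1 := integral_mono (integrable_const (f y)) (integrable_continuousMap ρ f)
      fun z => (hz z).1
    have h2 := integral_mono (integrable_continuousMap ρ f) (integrable_const (f x))
      fun z => (hz z).2
    simp only [integral_const, probReal_univ, one_smul] at h1 h2
    exact ⟨h1, h2⟩
  rw [h]
  exact abs_sub_le_of_le_of_le (key μ).1 (key μ).2 (key ν).1 (key ν).2

/-- The integrals of `A n f` against two probability measures differ by at most `osc (A n f)`, and
testing Lipschitz functions suffices for weak convergence. -/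
theorem tendsto_of_tendsto_osc [Nonempty X] {μs : ℕ → ProbabilityMeasure (stdSimplex ℝ X)}
    {μ lam : ProbabilityMeasure (stdSimplex ℝ X)}
    {A : ℕ → Module.End ℝ C(stdSimplex ℝ X, ℝ)}
    (hμ : ∀ n (f : C(stdSimplex ℝ X, ℝ)), ∫ α, f α ∂(μs n : Measure (stdSimplex ℝ X)) =
      ∫ α, A n f α ∂(μ : Measure (stdSimplex ℝ X)))
    (hlam : ∀ n (f : C(stdSimplex ℝ X, ℝ)), ∫ α, f α ∂(lam : Measure (stdSimplex ℝ X)) =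
      ∫ α, A n f α ∂(lam : Measure (stdSimplex ℝ X)))
    (hA : ∀ C f, IsConeLipschitz C f → Tendsto (fun n => osc (A n f)) atTop (𝓝 0)) :
    Tendsto μs atTop (𝓝 lam) := by
  refine tendsto_iff_forall_lipschitz_integral_tendsto.2 fun f _ ⟨L, hL⟩ => ?_
  obtain ⟨C, hC⟩ := exists_isConeLipschitz (f := ⟨f, hL.continuous⟩) hL
  refine tendsto_iff_norm_sub_tendsto_zero.2
    (squeeze_zero (fun n => norm_nonneg _) (fun n => ?_) (hA C _ hC))
  have h1 := hμ n ⟨f, hL.continuous⟩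
  have h2 := hlam n ⟨f, hL.continuous⟩
  simp only [ContinuousMap.coe_mk] at h1 h2
  rw [h1, h2, Real.norm_eq_abs]
  exact abs_integral_sub_integral_le_osc μ lam _

variable [DecidableEq X] [Fintype Y]

/-- The loss must vanish for every `l`, since the word length depends on the accuracy `η`, which in
turn depends on the target `ε`. -/
theorem tendsto_osc_zero (D : SteppingFamily X Y) [Nonempty X]
    (hrank : ∃ R ∈ closure D.cone, R.rank = 1) {K : Finset ℕ} (hK : K.Nonempty)
    (hpos : ∀ i j, 0 < ∑ k ∈ K, (D.trans ^ k) i j) {C : ℝ} {f : ℕ → C(stdSimplex ℝ X, ℝ)}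
    (hf : ∀ n, IsConeLipschitz C (f n))
    (hlim : ∀ l, Tendsto (fun n => osc (f n) - osc (D.powAverage K l (f n))) atTop (𝓝 0)) :
    Tendsto (fun n => osc (f n)) atTop (𝓝 0) := by
  obtain ⟨γ, κ, hκ, H⟩ := D.exists_minorization hrank hK hpos
  have hC : 0 ≤ C := (abs_nonneg _).trans ((hf 0).abs_le γ)
  refine tendsto_order.2 ⟨fun a ha => Eventually.of_forall fun n => ha.trans_le (osc_nonneg _),
    fun ε hε => ?_⟩
  -- This `η` makes the error `4Cη` at most `κε/2`; `C + 1` avoids dividing by zero.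
  obtain ⟨l, q, hq, Hq⟩ := H (κ * ε / (8 * (C + 1))) (by positivity)
  have hη : 4 * C * (κ * ε / (8 * (C + 1))) ≤ κ * ε / 2 := by
    rw [← mul_div_assoc, div_le_div_iff₀ (by positivity) two_pos]
    nlinarith [mul_pos hκ hε]
  filter_upwards [(tendsto_order.1 (hlim l)).2 (q * (κ * ε / 2)) (by positivity)] with n hn
  have h1 := mul_osc_le_of_minorization (D.isNonexpansive_powAverage hK l) Hq (hf n)
  have h2 := mul_le_mul_of_nonneg_left hη hq.le
  have h3 : q * (κ * osc (f n)) < q * (κ * ε) := by linarith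
  exact lt_of_mul_lt_mul_left (lt_of_mul_lt_mul_left h3 hq.le) hκ.le

theorem tendsto_osc_markovEnd_pow (D : SteppingFamily X Y) [Nonempty X]
    (hrank : ∃ R ∈ closure D.cone, R.rank = 1) (hprim : D.trans.IsPrimitive)
    {C : ℝ} {f : C(stdSimplex ℝ X, ℝ)} (hf : IsConeLipschitz C f) :
    Tendsto (fun n => osc ((D.markovEnd ^ n) f)) atTop (𝓝 0) := by
  obtain ⟨k, -, hk⟩ := hprim.exists_pos_pow
  have hT := D.isNonexpansive_markovEnd
  refine D.tendsto_osc_zero hrank (Finset.singleton_nonempty k) (by simpa using hk)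
    (fun n => (hT.pow n).coneLipschitz C f hf) fun l => ?_
  -- A monotone bounded sequence converges, so its differences over the fixed lag `k + l` tend to
  -- zero.
  have hanti : Antitone fun n => osc ((D.markovEnd ^ n) f) := antitone_nat_of_succ_le fun n => by
    rw [pow_succ', Module.End.mul_apply]
    exact hT.osc_le _
  have hc := tendsto_atTop_ciInf hanti ⟨0, by rintro _ ⟨n, rfl⟩; exact osc_nonneg _⟩
  have hs := hc.sub (hc.comp (tendsto_add_atTop_nat (k + l)))
  rw [sub_self] at hs
  refine hs.congr fun n => ?_
  simp only [Function.comp_apply, powAverage, Finset.card_singleton, Nat.cast_one, inv_one,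
    Finset.sum_singleton, one_smul, ← Module.End.mul_apply, ← pow_add, add_comm n]

theorem markovEnd_sub_one_mul_cesaro (D : SteppingFamily X Y) (n : ℕ) :
    (D.markovEnd - 1) * D.powAverage (Finset.range (n + 1)) 0 =
      ((n + 1 : ℕ) : ℝ)⁻¹ • (D.markovEnd ^ (n + 1) - 1) := by
  simp only [powAverage, add_zero, Finset.card_range, mul_smul_comm, mul_geom_sum]

theorem tendsto_markovEnd_cesaro_sub (D : SteppingFamily X Y) (f : C(stdSimplex ℝ X, ℝ)) :
    Tendsto (fun n => (D.markovEnd - 1) (D.powAverage (Finset.range (n + 1)) 0 f))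
      atTop (𝓝 0) := by
  have h0 : Tendsto (fun n : ℕ => ((n + 1 : ℕ) : ℝ)⁻¹ * (2 * ‖f‖)) atTop (𝓝 0) := by
    have := (tendsto_inv_atTop_nhds_zero_nat (𝕜 := ℝ)).comp (tendsto_add_atTop_nat 1)
    simpa using this.mul_const (2 * ‖f‖)
  refine squeeze_zero_norm (fun n => ?_) h0
  rw [← Module.End.mul_apply, markovEnd_sub_one_mul_cesaro, LinearMap.smul_apply, norm_smul,
    Real.norm_of_nonneg (by positivity)]
  refine mul_le_mul_of_nonneg_left ?_ (by positivity)
  rw [LinearMap.sub_apply, Module.End.one_apply]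
  linarith [norm_sub_le ((D.markovEnd ^ (n + 1)) f) f,
    (D.isNonexpansive_markovEnd.pow (n + 1)).norm_le f]

/-- Telescoping `T^k - 1 = ∑ i < k, T^i (T - 1)` turns asymptotic invariance under `T` into
asymptotic invariance under averages of its powers. -/
theorem tendsto_powAverage_sub (D : SteppingFamily X Y) {K : Finset ℕ} (hK : K.Nonempty) (l : ℕ)
    {f : ℕ → C(stdSimplex ℝ X, ℝ)}
    (hf : Tendsto (fun n => (D.markovEnd - 1) (f n)) atTop (𝓝 0)) :
    Tendsto (fun n => D.powAverage K l (f n) - f n) atTop (𝓝 0) := by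
  have hT := D.isNonexpansive_markovEnd
  have hpow : ∀ k, Tendsto (fun n => (D.markovEnd ^ k) (f n) - f n) atTop (𝓝 0) := fun k => by
    have h : Tendsto (fun n => ∑ i ∈ Finset.range k, (D.markovEnd ^ i) ((D.markovEnd - 1) (f n)))
        atTop (𝓝 (∑ i ∈ Finset.range k, 0)) :=
      tendsto_finsetSum _ fun i _ => (hT.pow i).tendsto_zero hf
    rw [Finset.sum_const_zero] at h
    refine h.congr fun n => ?_
    rw [← LinearMap.sum_apply, ← Module.End.mul_apply, geom_sum_mul, LinearMap.sub_apply,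
      Module.End.one_apply]
  have h : Tendsto (fun n => (K.card : ℝ)⁻¹ • ∑ k ∈ K, ((D.markovEnd ^ (k + l)) (f n) - f n))
      atTop (𝓝 ((K.card : ℝ)⁻¹ • ∑ k ∈ K, 0)) :=
    (tendsto_finsetSum _ fun k _ => hpow (k + l)).const_smul _
  rw [Finset.sum_const_zero, smul_zero] at h
  have hc : (K.card : ℝ) ≠ 0 := by simpa using hK.ne_empty
  refine h.congr fun n => ?_
  rw [Finset.sum_sub_distrib, smul_sub, Finset.sum_const, ← Nat.cast_smul_eq_nsmul ℝ,
    inv_smul_smul₀ hc, powAverage, LinearMap.smul_apply, LinearMap.sum_apply]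

theorem trans_nonneg (D : SteppingFamily X Y) (i j : X) : 0 ≤ D.trans i j := by
  rw [trans, Matrix.sum_apply]
  exact Finset.sum_nonneg fun y _ => D.mat_nonneg y i j

theorem exists_sum_pow_pos (D : SteppingFamily X Y) (hirr : D.trans.IsIrreducible) :
    ∃ K : Finset ℕ, K.Nonempty ∧ ∀ i j, 0 < ∑ k ∈ K, (D.trans ^ k) i j := by
  choose k _ hk using (Matrix.isIrreducible_iff_exists_pow_pos D.trans_nonneg).1 hirr
  -- The exponent `0` keeps `K` nonempty even when `X` is empty; its contribution is nonnegative.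
  refine ⟨insert 0 (Finset.univ.image fun p : X × X => k p.1 p.2), Finset.insert_nonempty _ _,
    fun i j => Finset.sum_pos' (fun m _ => Matrix.pow_apply_nonneg D.trans_nonneg m i j)
      ⟨k i j, ?_, hk i j⟩⟩
  exact Finset.mem_insert_of_mem (Finset.mem_image_of_mem (fun p : X × X => k p.1 p.2)
    (Finset.mem_univ (i, j)))

theorem tendsto_osc_cesaro (D : SteppingFamily X Y) [Nonempty X]
    (hrank : ∃ R ∈ closure D.cone, R.rank = 1) (hirr : D.trans.IsIrreducible)
    {C : ℝ} {f : C(stdSimplex ℝ X, ℝ)} (hf : IsConeLipschitz C f) :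
    Tendsto (fun n => osc (D.powAverage (Finset.range (n + 1)) 0 f)) atTop (𝓝 0) := by
  obtain ⟨K, hK, hpos⟩ := D.exists_sum_pow_pos hirr
  refine D.tendsto_osc_zero hrank hK hpos (C := C)
    (fun n => (D.isNonexpansive_powAverage (by simp) 0).coneLipschitz C f hf) fun l => ?_
  have h := (D.tendsto_powAverage_sub hK l (D.tendsto_markovEnd_cesaro_sub f)).norm.const_mul 2
  rw [norm_zero, mul_zero] at h
  refine squeeze_zero (fun n => sub_nonneg.2 ((D.isNonexpansive_powAverage hK l).osc_le _))
    (fun n => ?_) h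
  rw [norm_sub_rev]
  exact osc_sub_le _ _

/-! ### Duality and stationary distributions -/

theorem integral_dual_iterate (D : SteppingFamily X Y) (μ : ProbabilityMeasure (stdSimplex ℝ X))
    (n : ℕ) (f : C(stdSimplex ℝ X, ℝ)) :
    ∫ β, f β ∂(D.dual^[n] μ : Measure (stdSimplex ℝ X)) =
      ∫ α, (D.markovEnd ^ n) f α ∂(μ : Measure (stdSimplex ℝ X)) := by
  induction n generalizing f with
  | zero => rfl
  | succ n ih =>
    rw [Function.iterate_succ_apply', integral_dual, pow_succ, Module.End.mul_apply]
    exact ih (D.markovEnd f)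

theorem integral_cesaroMean (D : SteppingFamily X Y) (μ : ProbabilityMeasure (stdSimplex ℝ X))
    (n : ℕ) (f : C(stdSimplex ℝ X, ℝ)) :
    ∫ β, f β ∂(D.cesaroMean μ n : Measure (stdSimplex ℝ X)) =
      ∫ α, D.powAverage (Finset.range (n + 1)) 0 f α ∂(μ : Measure (stdSimplex ℝ X)) := by
  simp only [cesaroMean, ProbabilityMeasure.coe_mk, powAverage, add_zero, LinearMap.smul_apply,
    LinearMap.sum_apply, ContinuousMap.smul_apply, ContinuousMap.coe_sum, Finset.sum_apply]
  rw [integral_smul_measure, integral_finsetSum_measure fun k _ => integrable_continuousMap _ f,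
    integral_smul, integral_finsetSum _ fun k _ => integrable_continuousMap μ _]
  simp only [integral_dual_iterate, Finset.card_range]
  rw [ENNReal.toReal_inv, ENNReal.toReal_natCast]

theorem IsStationary.iterate {D : SteppingFamily X Y} {μ : ProbabilityMeasure (stdSimplex ℝ X)}
    (h : D.IsStationary μ) (n : ℕ) : D.dual^[n] μ = μ :=
  Function.iterate_fixed h n

theorem IsStationary.cesaroMean {D : SteppingFamily X Y}
    {μ : ProbabilityMeasure (stdSimplex ℝ X)} (h : D.IsStationary μ) (n : ℕ) :
    D.cesaroMean μ n = μ := by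
  apply Subtype.ext
  change ((n + 1 : ℕ) : ℝ≥0∞)⁻¹ • ∑ k ∈ Finset.range (n + 1),
    ((D.dual^[k] μ : ProbabilityMeasure (stdSimplex ℝ X)) : Measure (stdSimplex ℝ X)) = μ.1
  simp only [h.iterate, Finset.sum_const, Finset.card_range]
  rw [← Nat.cast_smul_eq_nsmul ℝ≥0∞, smul_smul,
    ENNReal.inv_mul_cancel (by simp) (ENNReal.natCast_ne_top _), one_smul]
  rfl

theorem continuous_dual (D : SteppingFamily X Y) : Continuous D.dual := by
  refine continuous_iff_continuousAt.2 fun μ => tendsto_of_forall_continuousMap fun f => ?_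
  simp only [integral_dual]
  exact tendsto_integral_continuousMap tendsto_id _

/-- Krylov–Bogolyubov: the `α`-chain has a stationary distribution. -/
theorem exists_isStationary (D : SteppingFamily X Y) [Nonempty X] :
    ∃ lam, D.IsStationary lam := by
  let μ : ProbabilityMeasure (stdSimplex ℝ X) :=
    ⟨Measure.dirac (Classical.arbitrary _), inferInstance⟩
  let U : Ultrafilter ℕ := Ultrafilter.of atTop
  have hU : (U : Filter ℕ) ≤ atTop := Ultrafilter.of_le atTop
  obtain ⟨lam, -, hlam⟩ := isCompact_univ.ultrafilter_le_nhds (U.map (D.cesaroMean μ)) (by simp)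
  have hlim : Tendsto (D.cesaroMean μ) U (𝓝 lam) := hlam
  -- Along the ultrafilter, `T*` of the Cesàro means tends to `T* lam` by continuity; it remains to
  -- see that it also tends to `lam`.
  refine ⟨lam, tendsto_nhds_unique ((D.continuous_dual.tendsto lam).comp hlim) ?_⟩
  refine tendsto_of_forall_continuousMap fun f => ?_
  have h0 : Tendsto (fun n => ∫ α, (D.markovEnd - 1)
      (D.powAverage (Finset.range (n + 1)) 0 f) α ∂(μ : Measure (stdSimplex ℝ X)))
      (U : Filter ℕ) (𝓝 0) := by
    refine squeeze_zero_norm (fun n => ?_) ((by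
      simpa using (D.tendsto_markovEnd_cesaro_sub f).norm : Tendsto _ atTop (𝓝 (0 : ℝ))).mono_left hU)
    simpa using norm_integral_le_of_norm_le_const (μ := (μ : Measure (stdSimplex ℝ X)))
      (ae_of_all _ fun α => ((D.markovEnd - 1)
        (D.powAverage (Finset.range (n + 1)) 0 f)).norm_coe_le_norm α)
  have h1 := h0.add (tendsto_integral_continuousMap hlim f)
  rw [zero_add] at h1
  refine h1.congr fun n => ?_
  have hcomm : D.markovEnd (D.powAverage (Finset.range (n + 1)) 0 f)
      = D.powAverage (Finset.range (n + 1)) 0 (D.markovEnd f) := by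
    simp only [← Module.End.mul_apply]
    congr 1
    simp only [powAverage, add_zero, mul_smul_comm, smul_mul_assoc, Finset.mul_sum,
      Finset.sum_mul, ← pow_succ, ← pow_succ']
  rw [integral_cesaroMean, ← integral_add (integrable_continuousMap μ _)
    (integrable_continuousMap μ _)]
  simp only [Function.comp_apply, integral_dual]
  change _ = ∫ α, (D.markovEnd f) α ∂(D.cesaroMean μ n : Measure (stdSimplex ℝ X))
  rw [integral_cesaroMean, ← hcomm]
  refine integral_congr_ae (ae_of_all _ fun α => ?_)
  simp

end SteppingFamily

theorem theorem2 {X Y : Type*} [Fintype X] [DecidableEq X] [Fintype Y]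
    (D : SteppingFamily X Y)
    (hirr : D.trans.IsIrreducible)
    (hrank : ∃ R ∈ closure D.cone, R.rank = 1) :
    ∃ lam : ProbabilityMeasure (stdSimplex ℝ X),
      D.IsStationary lam ∧
      (∀ ν : ProbabilityMeasure (stdSimplex ℝ X), D.IsStationary ν → ν = lam) ∧
      (∀ μ : ProbabilityMeasure (stdSimplex ℝ X),
        Tendsto (fun n : ℕ => D.cesaroMean μ n) atTop (𝓝 lam)) ∧
      (D.trans.IsPrimitive →
        ∀ μ : ProbabilityMeasure (stdSimplex ℝ X),
          Tendsto (fun n : ℕ => D.dual^[n] μ) atTop (𝓝 lam)) := by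
  -- Over an empty index set every matrix is zero and has rank `0`.
  have : Nonempty X := by
    by_contra hX
    rw [not_nonempty_iff] at hX
    obtain ⟨R, -, hR⟩ := hrank
    simp [Subsingleton.elim R 0] at hR
  obtain ⟨lam, hlam⟩ := D.exists_isStationary
  have hces : ∀ μ : ProbabilityMeasure (stdSimplex ℝ X),
      Tendsto (fun n : ℕ => D.cesaroMean μ n) atTop (𝓝 lam) := fun μ =>
    SteppingFamily.tendsto_of_tendsto_osc (fun n f => D.integral_cesaroMean μ n f)
      (fun n f => by rw [← D.integral_cesaroMean, hlam.cesaroMean])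
      fun C f hf => D.tendsto_osc_cesaro hrank hirr hf
  refine ⟨lam, hlam, fun ν hν => ?_, hces, fun hprim μ =>
    SteppingFamily.tendsto_of_tendsto_osc (fun n f => D.integral_dual_iterate μ n f)
      (fun n f => by rw [← D.integral_dual_iterate, hlam.iterate])
      fun C f hf => D.tendsto_osc_markovEnd_pow hrank hprim hf⟩
  -- A stationary `ν` equals each of its Cesàro means, which converge to `lam`.
  exact tendsto_nhds_unique (by simp only [hν.cesaroMean]; exact tendsto_const_nhds) (hces ν)
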